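/- Let $X_1,X_2$ be independent and uniformly distributed on $[0,1)$, and let $f(x_1,x_2)=1$ if $x_1\ge x_2$ and $f(x_1,x_2)=0$ if $x_1<x_2$, for $(x_1,x_2)\in[0,1)^2$. A combinatorial rectangle is a product $A\times B$ in which each of $A$ and $B$ is a countable union of intervals of $\mathbb{R}$ (degenerate and empty intervals are allowed). A zero-error rectangular partition $(\mathcal P,\mathcal Q)$ consists of two countable families of pairwise disjoint combinatorial rectangles, those of $\mathcal P$ contained in $f^{-1}(1)$ and those of $\mathcal Q$ contained in $f^{-1}(0)$, whose union contains $(X_1,X_2)$ with probability one. Its entropy is $-\sum_i p_i\log_2 p_i-\sum_i q_i\log_2 q_i\in[0,\infty]$, where $p_i$ and $q_i$ are the probabilities of the cells of $\mathcal P$ and of $\mathcal Q$. Theorem. If a zero-error rectangular partition $(\mathcal P,\mathcal Q)$ has the smallest entropy among all zero-error rectangular partitions, then there are $u,v$ with $0<u<1$ and $0<v<1$ such that, up to sets of Lebesgue measure zero, some cell of $\mathcal P$ is the rectangle $[v,1]\times[0,v]$, with opposite vertices $(1,0)$ and $(v,v)$, and some cell of $\mathcal Q$ is the rectangle $[0,u]\times[u,1]$,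 with opposite vertices $(0,1)$ and $(u,u)$. More precisely, each of these two closed rectangles is the closure of the corresponding cell, and exceeds it only by a set of measure zero. -/

import Mathlib

open Set MeasureTheory
open scoped ENNReal

noncomputable section

namespace ComparisonPartition

/-- The unit square `[0,1) × [0,1)` in which the pair `(X₁, X₂)` lives. -/
def unitSquare : Set (ℝ × ℝ) := Ico (0 : ℝ) 1 ×ˢ Ico (0 : ℝ) 1

/-- The comparison classifier for two nodes with weights `+1, -1` and threshold `0`:
the value is `1` if `x₁ - x₂ ≥ 0` and `0` if `x₁ - x₂ < 0`. -/
def classifier (x : ℝ × ℝ) : ℕ := if 0 ≤ x.1 - x.2 then 1 else 0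

/-- The part `{x : f x = c}` of the unit square on which the classifier takes the value `c`. -/
def classRegion (c : ℕ) : Set (ℝ × ℝ) := {x ∈ unitSquare | classifier x = c}

/-- The law of `(X₁, X₂)`, with `X₁, X₂` independent and uniformly distributed on `[0,1)`. -/
def law : Measure (ℝ × ℝ) :=
  (volume.restrict (Ico (0 : ℝ) 1)).prod (volume.restrict (Ico (0 : ℝ) 1))

/-- A countable union of intervals of the real line. An interval is an order-connected set: it may
be open, closed or half-open, may be a single point, and may be empty. -/
def IsUnionOfIntervals (A : Set ℝ) : Prop :=
  ∃ I : ℕ → Set ℝ, (∀ n, (I n).OrdConnected) ∧ A = ⋃ n, I n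

/-- A combinatorial rectangle: the Cartesian product of two unions of intervals. -/
def IsCombRectangle (R : Set (ℝ × ℝ)) : Prop :=
  ∃ A B : Set ℝ, IsUnionOfIntervals A ∧ IsUnionOfIntervals B ∧ R = A ×ˢ B

/-- A zero-error rectangular partition `(𝒫, 𝒬)` of the unit square. The two countable families
`P 0, P 1, …` and `Q 0, Q 1, …` consist of pairwise disjoint combinatorial rectangles, the first
inside the region where the classifier is `1`, the second inside the region where it is `0`, and
together they cover the unit square with probability one. Empty cells are allowed, so finite
families are included; an empty cell contributes nothing to the entropy. (A countable family
cannot cover every point of the diagonal: each zero-error rectangle has at most one point there.) -/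
structure ZeroErrorPartition where
  P : ℕ → Set (ℝ × ℝ)
  Q : ℕ → Set (ℝ × ℝ)
  rect_P : ∀ i, IsCombRectangle (P i)
  rect_Q : ∀ i, IsCombRectangle (Q i)
  sub_P : ∀ i, P i ⊆ classRegion 1
  sub_Q : ∀ i, Q i ⊆ classRegion 0
  disjoint_P : ∀ i j, i ≠ j → Disjoint (P i) (P j)
  disjoint_Q : ∀ i j, i ≠ j → Disjoint (Q i) (Q j)
  cover : ∀ᵐ x ∂law, x ∈ (⋃ i, P i) ∪ ⋃ i, Q i

/-- The contribution `-p log₂ p` (in bits) of a cell of probability `p`; it is `0` for `p = 0`. -/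
def cellEntropy (R : Set (ℝ × ℝ)) : ℝ≥0∞ :=
  ENNReal.ofReal (-(law.real R * Real.logb 2 (law.real R)))

/-- The entropy of a partition, in bits, as a sum of nonnegative terms with values in `[0, ∞]`. -/
def ZeroErrorPartition.entropy (𝒮 : ZeroErrorPartition) : ℝ≥0∞ :=
  ∑' i, cellEntropy (𝒮.P i) + ∑' i, cellEntropy (𝒮.Q i)

/-- `𝒮` has the smallest entropy among all zero-error rectangular partitions. -/
def ZeroErrorPartition.MinimizesEntropy (𝒮 : ZeroErrorPartition) : Prop :=
  ∀ 𝒮' : ZeroErrorPartition, 𝒮.entropy ≤ 𝒮'.entropy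

/-- `R` is the axis-parallel rectangle with opposite vertices `a` and `b`, up to a null set. Here
`uIcc a b` is the closed axis-parallel rectangle with these opposite vertices; `R` lies in it, fills
it except for a set of Lebesgue measure zero, and has it as its closure. -/
def IsRectangleWithVertices (R : Set (ℝ × ℝ)) (a b : ℝ × ℝ) : Prop :=
  closure R = uIcc a b ∧ volume (uIcc a b \ R) = 0

end ComparisonPartition

end

/-! The diagonal is null, so `classRegion 1` and the mirror image of `classRegion 0` are the same
triangle `T` up to a null set, and it suffices to treat a partition of `T` of smallest entropy.

Let `F k` be a cell of largest probability. A rectangle `A × B` in `T` has `b ≤ v ≤ a` for some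
`v` and all `a ∈ A`, `b ∈ B`, so `F k` lies in `[v, 1] × [0, v]`, that is, almost surely in
`V = [v, 1) × [0, v)`. Replacing `F k` by `V` and every other cell `R` by `R \ V` gives a partition
again, because `R \ V` is a rectangle: if `B` lies below `v`, one cuts `A` down to the part below
`v`, and otherwise one cuts `B` down to the part above `v`.

This moves mass from smaller cells to the largest one. Let `φ(t) = -t log t`, let `p_k` be the
probability of `F k`, and let `c` be the slope of `φ` at `p_k`. Concavity gives
`φ(q) ≤ φ(p) + c (q - p)` for `q ≤ p ≤ p_k` and `φ(q) < φ(p_k) + c (q - p_k)` for `q > p_k`. The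
linear terms sum to zero, so the entropy drops strictly unless `F k` already has the probability of
`V`. The comparison needs the smallest entropy to be finite, which the partition of `T` into dyadic
squares shows: level `k` has `2ᵏ` squares of area `4⁻ᵏ⁻¹`. -/

namespace ComparisonPartition

section Concavity

variable {S : Set ℝ} {φ : ℝ → ℝ} {c m x y : ℝ}

theorem concaveOn_le_add_mul_sub (hφ : ConcaveOn ℝ S φ) (hd : HasDerivAt φ c m) (hm : m ∈ S)
    (hy : y ∈ S) (hyx : y ≤ x) (hxm : x ≤ m) : φ y ≤ φ x + c * (y - x) := by
  rcases hyx.eq_or_lt with rfl | hyx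
  · simp
  have hslope : c ≤ slope φ y x :=
    (hφ.le_slope_of_hasDerivAt hy hm (hyx.trans_le hxm) hd).trans
      (hφ.slope_anti hy ⟨hφ.1.ordConnected.out hy hm ⟨hyx.le, hxm⟩, hyx.ne'⟩
        ⟨hm, (hyx.trans_le hxm).ne'⟩ hxm)
  rw [slope_def_field, le_div_iff₀ (sub_pos.2 hyx)] at hslope
  linarith

theorem strictConcaveOn_lt_add_mul_sub (hφ : StrictConcaveOn ℝ S φ) (hd : HasDerivAt φ c m)
    (hm : m ∈ S) (hy : y ∈ S) (hmy : m < y) : φ y < φ m + c * (y - m) := by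
  have hslope := hφ.slope_lt_of_hasDerivAt hm hy hmy hd
  rw [slope_def_field, div_lt_iff₀ (sub_pos.2 hmy)] at hslope
  linarith

variable {ι : Type*} {p q : ι → ℝ} {k : ι} {s : ℝ}

theorem summable_comp_and_tsum_comp_lt (hφ : StrictConcaveOn ℝ S φ) (hd : HasDerivAt φ c (p k))
    (hpk : p k ∈ S) (hqS : ∀ i, q i ∈ S) (hφq : ∀ i, 0 ≤ φ (q i)) (hmax : ∀ i, p i ≤ p k)
    (hle : ∀ i, i ≠ k → q i ≤ p i) (hlt : p k < q k) (hp : HasSum p s) (hq : HasSum q s)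
    (hφp : Summable fun i => φ (p i)) :
    (Summable fun i => φ (q i)) ∧ ∑' i, φ (q i) < ∑' i, φ (p i) := by
  have hk : φ (q k) < φ (p k) + c * (q k - p k) :=
    strictConcaveOn_lt_add_mul_sub hφ hd hpk (hqS k) hlt
  have hbound (i : ι) : φ (q i) ≤ φ (p i) + c * (q i - p i) := by
    by_cases hi : i = k
    · exact hi ▸ hk.le
    · exact concaveOn_le_add_mul_sub hφ.concaveOn hd hpk (hqS i) (hle i hi) (hmax i)
  have hsum : HasSum (fun i => φ (p i) + c * (q i - p i)) (∑' i, φ (p i)) := by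
    simpa using hφp.hasSum.add ((hq.sub hp).mul_left c)
  have hφq' : Summable fun i => φ (q i) := .of_nonneg_of_le hφq hbound hsum.summable
  exact ⟨hφq', (hφq'.tsum_lt_tsum hbound hk hsum.summable).trans_eq hsum.tsum_eq⟩

end Concavity

theorem exists_forall_le_of_summable {ι : Type*} {p : ι → ℝ} (hp : Summable p) {j : ι}
    (hj : 0 < p j) : ∃ k, ∀ i, p i ≤ p k := by
  let _ : TopologicalSpace ι := ⊥
  have : DiscreteTopology ι := ⟨rfl⟩
  refine continuous_of_discreteTopology.exists_forall_ge' j ?_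
  rw [Filter.cocompact_eq_cofinite]
  exact hp.tendsto_cofinite_zero.eventually_le_const hj

theorem ae_prod_fst_ne_snd {α : Type*} [MeasurableSpace α] [MeasurableEq α]
    (μ ν : Measure α) [SFinite ν] [NullSingletonClass ν] :
    ∀ᵐ x ∂μ.prod ν, x.1 ≠ x.2 := by
  have hdiag : MeasurableSet {x : α × α | x.1 ≠ x.2} :=
    (measurableSet_eq_fun measurable_fst measurable_snd).compl
  refine (Measure.ae_prod_iff_ae_ae hdiag).2 (.of_forall fun a => ?_)
  filter_upwards [Measure.ae_ne ν a] with b hb using hb.symm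

theorem closure_eq_of_measure_sdiff_eq_zero {X : Type*} [TopologicalSpace X] [MeasurableSpace X]
    {μ : Measure X} [μ.IsOpenPosMeasure] {R K : Set X} (hK : IsClosed K)
    (hK' : K ⊆ closure (interior K)) (hRK : R ⊆ K) (hnull : μ (K \ R) = 0) : closure R = K := by
  have hint : interior K ⊆ closure R := by
    rw [← sdiff_eq_empty, ← (isOpen_interior.sdiff isClosed_closure).measure_eq_zero_iff μ]
    exact measure_mono_null (sdiff_subset_sdiff interior_subset subset_closure) hnull
  exact (closure_minimal hRK hK).antisymm (hK'.trans (closure_minimal hint isClosed_closure))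

theorem IsUnionOfIntervals.measurableSet {A : Set ℝ} (hA : IsUnionOfIntervals A) :
    MeasurableSet A := by
  obtain ⟨I, hI, rfl⟩ := hA
  exact .iUnion fun n => (hI n).measurableSet

theorem isUnionOfIntervals_of_ordConnected {A : Set ℝ} (hA : A.OrdConnected) :
    IsUnionOfIntervals A :=
  ⟨fun _ => A, fun _ => hA, (iUnion_const A).symm⟩

theorem IsUnionOfIntervals.inter_ordConnected {A J : Set ℝ} (hA : IsUnionOfIntervals A)
    (hJ : J.OrdConnected) : IsUnionOfIntervals (A ∩ J) := by
  obtain ⟨I, hI, rfl⟩ := hA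
  exact ⟨fun n => I n ∩ J, fun n => (hI n).inter hJ, iUnion_inter _ _⟩

theorem IsCombRectangle.measurableSet {R : Set (ℝ × ℝ)} (hR : IsCombRectangle R) :
    MeasurableSet R := by
  obtain ⟨A, B, hA, hB, rfl⟩ := hR
  exact hA.measurableSet.prod hB.measurableSet

theorem IsCombRectangle.preimage_swap {R : Set (ℝ × ℝ)} (hR : IsCombRectangle R) :
    IsCombRectangle (Prod.swap ⁻¹' R) := by
  obtain ⟨A, B, hA, hB, rfl⟩ := hR
  exact ⟨B, A, hB, hA, preimage_swap_prod _ _⟩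

theorem isCombRectangle_Ico_prod_Ico (a b c d : ℝ) : IsCombRectangle (Ico a b ×ˢ Ico c d) :=
  ⟨_, _, isUnionOfIntervals_of_ordConnected ordConnected_Ico,
    isUnionOfIntervals_of_ordConnected ordConnected_Ico, rfl⟩

theorem mem_classRegion_one {x : ℝ × ℝ} : x ∈ classRegion 1 ↔ x ∈ unitSquare ∧ x.2 ≤ x.1 := by
  simp [classRegion, classifier]

theorem mem_classRegion_zero {x : ℝ × ℝ} : x ∈ classRegion 0 ↔ x ∈ unitSquare ∧ x.1 < x.2 := by
  simp [classRegion, classifier]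

/-- The half `x₂ < x₁` of the unit square. It is the mirror image of `classRegion 0`, and it differs
from `classRegion 1` by the diagonal only, so that both classes can be treated as partitions of a
region `T` with `openTriangle ⊆ T ⊆ classRegion 1`. -/
def openTriangle : Set (ℝ × ℝ) := Prod.swap ⁻¹' classRegion 0

theorem mem_openTriangle {x : ℝ × ℝ} : x ∈ openTriangle ↔ x ∈ unitSquare ∧ x.2 < x.1 := by
  simp only [openTriangle, mem_preimage, mem_classRegion_zero, unitSquare, mem_prod, Prod.fst_swap,
    Prod.snd_swap, and_comm]

theorem openTriangle_subset_classRegion_one : openTriangle ⊆ classRegion 1 := fun _ hx =>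
  mem_classRegion_one.2 ((mem_openTriangle.1 hx).imp_right le_of_lt)

section Law

theorem law_eq_restrict : law = volume.restrict unitSquare :=
  Measure.prod_restrict _ _

instance : IsProbabilityMeasure law := by
  have : IsProbabilityMeasure (volume.restrict (Ico (0 : ℝ) 1)) := ⟨by simp⟩
  unfold law
  infer_instance

theorem law_real_Ico_prod_Ico {a b c d : ℝ} (ha : 0 ≤ a) (hab : a ≤ b) (hb : b ≤ 1) (hc : 0 ≤ c)
    (hcd : c ≤ d) (hd : d ≤ 1) : law.real (Ico a b ×ˢ Ico c d) = (b - a) * (d - c) := by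
  have hsub : Ico a b ×ˢ Ico c d ⊆ unitSquare :=
    prod_mono (Ico_subset_Ico ha hb) (Ico_subset_Ico hc hd)
  rw [law_eq_restrict, measureReal_restrict_apply (measurableSet_Ico.prod measurableSet_Ico),
    inter_eq_left.2 hsub, Measure.volume_eq_prod, measureReal_prod_prod,
    Real.volume_real_Ico_of_le hab, Real.volume_real_Ico_of_le hcd]

theorem measurePreserving_swap_law : MeasurePreserving Prod.swap law law :=
  Measure.measurePreserving_swap

theorem cellEntropy_preimage_swap (R : Set (ℝ × ℝ)) :
    cellEntropy (Prod.swap ⁻¹' R) = cellEntropy R := by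
  have hlaw : law.real (Prod.swap ⁻¹' R) = law.real R := congrArg ENNReal.toReal <|
    measurePreserving_swap_law.measure_preimage_equiv (f := MeasurableEquiv.prodComm) R
  rw [cellEntropy, hlaw, cellEntropy]

theorem cellEntropy_eq_ofReal_negMulLog (R : Set (ℝ × ℝ)) :
    cellEntropy R = ENNReal.ofReal (Real.negMulLog (law.real R) / Real.log 2) := by
  rw [cellEntropy, Real.negMulLog, Real.logb]
  congr 1
  ring

theorem negMulLog_law_nonneg (R : Set (ℝ × ℝ)) : 0 ≤ Real.negMulLog (law.real R) :=
  Real.negMulLog_nonneg measureReal_nonneg measureReal_le_one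

variable {ι : Type*} {F G : ι → Set (ℝ × ℝ)}

theorem summable_negMulLog_law (h : ∑' i, cellEntropy (F i) ≠ ∞) :
    Summable fun i => Real.negMulLog (law.real (F i)) := by
  have hlog : 0 < Real.log 2 := Real.log_pos one_lt_two
  refine ((ENNReal.summable_toReal h).mul_right (Real.log 2)).congr fun i => ?_
  rw [cellEntropy_eq_ofReal_negMulLog,
    ENNReal.toReal_ofReal (div_nonneg (negMulLog_law_nonneg _) hlog.le),
    div_mul_cancel₀ _ hlog.ne']

theorem tsum_cellEntropy_eq_ofReal (h : Summable fun i => Real.negMulLog (law.real (F i))) :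
    ∑' i, cellEntropy (F i) =
      ENNReal.ofReal ((∑' i, Real.negMulLog (law.real (F i))) / Real.log 2) := by
  simp only [cellEntropy_eq_ofReal_negMulLog]
  rw [← tsum_div_const, ENNReal.ofReal_tsum_of_nonneg
    (fun i => div_nonneg (negMulLog_law_nonneg _) (Real.log_pos one_lt_two).le) (h.div_const _)]

theorem tsum_cellEntropy_lt_of_law_lt {k : ι} {s : ℝ} (hpos : 0 < law.real (F k))
    (hmax : ∀ i, law.real (F i) ≤ law.real (F k)) (hGF : ∀ i, i ≠ k → G i ⊆ F i)
    (hlt : law.real (F k) < law.real (G k)) (hF : HasSum (fun i => law.real (F i)) s)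
    (hG : HasSum (fun i => law.real (G i)) s) (hfin : ∑' i, cellEntropy (F i) ≠ ∞) :
    ∑' i, cellEntropy (G i) < ∑' i, cellEntropy (F i) := by
  obtain ⟨hsummable, htsum⟩ := summable_comp_and_tsum_comp_lt
    (p := fun i => law.real (F i)) (q := fun i => law.real (G i)) Real.strictConcaveOn_negMulLog
    (Real.hasDerivAt_negMulLog hpos.ne') hpos.le (fun _ => measureReal_nonneg)
    (fun i => negMulLog_law_nonneg (G i)) hmax (fun i hi => measureReal_mono (hGF i hi)) hlt hF hG
    (summable_negMulLog_law hfin)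
  rw [tsum_cellEntropy_eq_ofReal hsummable,
    tsum_cellEntropy_eq_ofReal (summable_negMulLog_law hfin)]
  have hnonneg : 0 ≤ ∑' i, Real.negMulLog (law.real (G i)) :=
    tsum_nonneg fun i => negMulLog_law_nonneg (G i)
  have hlog : 0 < Real.log 2 := Real.log_pos one_lt_two
  exact (ENNReal.ofReal_lt_ofReal_iff (div_pos (hnonneg.trans_lt htsum) hlog)).2
    (div_lt_div_of_pos_right htsum hlog)

end Law

/-- A partition of the region `T`, up to a `law`-null set, into combinatorial rectangles contained
in `T`. A zero-error partition consists of such partitions of `classRegion 1` and of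
`classRegion 0`. -/
structure IsRectPartition {ι : Type*} (T : Set (ℝ × ℝ)) (F : ι → Set (ℝ × ℝ)) : Prop where
  isCombRectangle : ∀ i, IsCombRectangle (F i)
  subset : ∀ i, F i ⊆ T
  disjoint : Pairwise (Function.onFun Disjoint F)
  ae_mem_iUnion : ∀ᵐ x ∂law, x ∈ T → x ∈ ⋃ i, F i

namespace IsRectPartition

variable {ι ι' : Type*} {S T V : Set (ℝ × ℝ)} {F : ι → Set (ℝ × ℝ)}

theorem hasSum_law [Countable ι] (hF : IsRectPartition T F) :
    HasSum (fun i => law.real (F i)) (law.real T) := by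
  have hae : ⋃ i, F i =ᵐ[law] T :=
    (LE.le.eventuallyLE (iUnion_subset hF.subset)).antisymm hF.ae_mem_iUnion
  have hmeas := measure_iUnion (μ := law) hF.disjoint fun i => (hF.isCombRectangle i).measurableSet
  rw [← measureReal_congr hae, measureReal_def, hmeas,
    ENNReal.tsum_toReal_eq fun i => measure_ne_top _ _]
  exact ENNReal.hasSum_toReal (hmeas ▸ measure_ne_top _ _)

theorem preimage_swap (hF : IsRectPartition T F) :
    IsRectPartition (Prod.swap ⁻¹' T) fun i => Prod.swap ⁻¹' F i where
  isCombRectangle i := (hF.isCombRectangle i).preimage_swap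
  subset i := preimage_mono (hF.subset i)
  disjoint _ _ hij := (hF.disjoint hij).preimage _
  ae_mem_iUnion := by
    rw [← preimage_iUnion]
    exact measurePreserving_swap_law.quasiMeasurePreserving.ae hF.ae_mem_iUnion

theorem comp_equiv (hF : IsRectPartition T F) (e : ι' ≃ ι) : IsRectPartition T (F ∘ e) where
  isCombRectangle i := hF.isCombRectangle (e i)
  subset i := hF.subset (e i)
  disjoint := hF.disjoint.comp_of_injective e.injective
  ae_mem_iUnion := by
    simpa only [Function.comp_apply, e.surjective.iUnion_comp F] using hF.ae_mem_iUnion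

theorem mono_of_ae_le (hF : IsRectPartition S F) (hST : S ⊆ T) (hTS : T ≤ᵐ[law] S) :
    IsRectPartition T F where
  isCombRectangle := hF.isCombRectangle
  subset i := (hF.subset i).trans hST
  disjoint := hF.disjoint
  ae_mem_iUnion := by
    filter_upwards [hF.ae_mem_iUnion, hTS] with x hx hTSx using hx ∘ hTSx

theorem update_sdiff [DecidableEq ι] (hF : IsRectPartition T F) {k : ι} (hV : IsCombRectangle V)
    (hVT : V ⊆ T) (hFV : ∀ i, IsCombRectangle (F i \ V)) (hk : F k ≤ᵐ[law] V) :
    IsRectPartition T (Function.update (fun i => F i \ V) k V) where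
  isCombRectangle := (Function.forall_update_iff _ fun _ => IsCombRectangle).2
    ⟨hV, fun i _ => hFV i⟩
  subset := (Function.forall_update_iff _ fun _ R => R ⊆ T).2
    ⟨hVT, fun i _ => sdiff_subset.trans (hF.subset i)⟩
  disjoint i j hij := by
    rcases eq_or_ne i k with rfl | hi
    · simpa [Function.onFun, hij.symm] using disjoint_sdiff_right
    rcases eq_or_ne j k with rfl | hj
    · simpa [Function.onFun, hij] using disjoint_sdiff_left
    · simpa [Function.onFun, hi, hj] using (hF.disjoint hij).mono sdiff_subset sdiff_subset
  ae_mem_iUnion := by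
    filter_upwards [hF.ae_mem_iUnion, hk] with x hx hkx hxT
    by_cases hxV : x ∈ V
    · exact mem_iUnion.2 ⟨k, by simpa using hxV⟩
    · obtain ⟨i, hi⟩ := mem_iUnion.1 (hx hxT)
      have hik : i ≠ k := by
        rintro rfl
        exact hxV (hkx hi)
      exact mem_iUnion.2 ⟨i, by simpa [hik] using ⟨hi, hxV⟩⟩

theorem exists_largest_cell [Countable ι] (hF : IsRectPartition T F) (hT : 0 < law.real T) :
    ∃ k, 0 < law.real (F k) ∧ ∀ i, law.real (F i) ≤ law.real (F k) := by
  have hsum := hF.hasSum_law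
  obtain ⟨j, hj⟩ : ∃ j, 0 < law.real (F j) := by
    by_contra! hnonpos
    exact hT.not_ge (hsum.nonpos hnonpos)
  obtain ⟨k, hk⟩ := exists_forall_le_of_summable hsum.summable hj
  exact ⟨k, hj.trans_le (hk j), hk⟩

end IsRectPartition

/-- A partition of `T` into countably many combinatorial rectangles whose entropy is the smallest
possible. The restriction of an optimal zero-error partition to either class has this property. -/
structure IsMinEntropyPartition (T : Set (ℝ × ℝ)) (F : ℕ → Set (ℝ × ℝ)) : Prop
    extends IsRectPartition T F where
  entropy_le : ∀ G : ℕ → Set (ℝ × ℝ), IsRectPartition T G →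
    ∑' i, cellEntropy (F i) ≤ ∑' i, cellEntropy (G i)

namespace IsMinEntropyPartition

variable {T V : Set (ℝ × ℝ)} {F : ℕ → Set (ℝ × ℝ)}

theorem preimage_swap (hF : IsMinEntropyPartition T F) :
    IsMinEntropyPartition (Prod.swap ⁻¹' T) fun i => Prod.swap ⁻¹' F i where
  toIsRectPartition := hF.toIsRectPartition.preimage_swap
  entropy_le G hG := by
    have hle := hF.entropy_le _ (by
      simpa only [← preimage_comp, Prod.swap_swap_eq, preimage_id] using hG.preimage_swap)
    simpa only [cellEntropy_preimage_swap] using hle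

theorem ae_eq_of_ae_le (hF : IsMinEntropyPartition T F) (hfin : ∑' i, cellEntropy (F i) ≠ ∞)
    {k : ℕ} (hpos : 0 < law.real (F k)) (hmax : ∀ i, law.real (F i) ≤ law.real (F k))
    (hV : IsCombRectangle V) (hVT : V ⊆ T) (hFV : ∀ i, IsCombRectangle (F i \ V))
    (hk : F k ≤ᵐ[law] V) : F k =ᵐ[law] V := by
  have hG := hF.toIsRectPartition.update_sdiff hV hVT hFV hk
  suffices hle : law.real V ≤ law.real (F k) from
    ae_eq_of_ae_subset_of_measure_ge hk
      ((ENNReal.toReal_le_toReal (measure_ne_top _ _) (measure_ne_top _ _)).1 hle)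
      (hF.isCombRectangle k).measurableSet.nullMeasurableSet (measure_ne_top _ _)
  by_contra! hlt
  refine (hF.entropy_le _ hG).not_gt (tsum_cellEntropy_lt_of_law_lt hpos hmax (fun i hi => ?_) ?_
    hF.hasSum_law hG.hasSum_law hfin)
  · simp only [Function.update_of_ne hi, sdiff_subset]
  · rwa [Function.update_self]

end IsMinEntropyPartition

section CornerRect

/-- The half-open rectangle with opposite vertices `(1, 0)` and `(v, v)`. Being closed on the left
and open at the top, it lies strictly below the diagonal, and removing it from a rectangle of
`classRegion 1` leaves a rectangle. -/
def cornerRect (v : ℝ) : Set (ℝ × ℝ) := Ico v 1 ×ˢ Ico 0 v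

theorem isCombRectangle_cornerRect (v : ℝ) : IsCombRectangle (cornerRect v) :=
  isCombRectangle_Ico_prod_Ico _ _ _ _

theorem cornerRect_subset_openTriangle (v : ℝ) : cornerRect v ⊆ openTriangle := fun _ hx =>
  mem_openTriangle.2 ⟨⟨⟨hx.2.1.trans (hx.2.2.le.trans hx.1.1), hx.1.2⟩,
    hx.2.1, hx.2.2.trans_le (hx.1.1.trans hx.1.2.le)⟩, hx.2.2.trans_le hx.1.1⟩

theorem cornerRect_ae_eq (v : ℝ) : cornerRect v =ᵐ[volume] Icc v 1 ×ˢ Icc 0 v :=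
  Measure.set_prod_ae_eq Ico_ae_eq_Icc Ico_ae_eq_Icc

variable {R T : Set (ℝ × ℝ)}

theorem isCombRectangle_sdiff_cornerRect (hR : IsCombRectangle R) (hRT : R ⊆ classRegion 1)
    (v : ℝ) : IsCombRectangle (R \ cornerRect v) := by
  obtain ⟨A, B, hA, hB, rfl⟩ := hR
  have hmem {a b : ℝ} (ha : a ∈ A) (hb : b ∈ B) := mem_classRegion_one.1 (hRT (mk_mem_prod ha hb))
  by_cases hBv : B ⊆ Iio v
  · refine ⟨A ∩ Iio v, B, hA.inter_ordConnected ordConnected_Iio, hB, ?_⟩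
    ext ⟨a, b⟩
    refine ⟨fun ⟨⟨ha, hb⟩, hV⟩ => ⟨⟨ha, mem_Iio.2 (not_le.1 fun hva => hV ?_)⟩, hb⟩,
      fun ⟨⟨ha, hav⟩, hb⟩ => ⟨⟨ha, hb⟩, fun hV => hav.not_ge hV.1.1⟩⟩
    exact ⟨⟨hva, (hmem ha hb).1.1.2⟩, (hmem ha hb).1.2.1, hBv hb⟩
  · obtain ⟨d, hd, hvd⟩ := not_subset.1 hBv
    refine ⟨A, B ∩ Ici v, hA, hB.inter_ordConnected ordConnected_Ici, ?_⟩
    ext ⟨a, b⟩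
    refine ⟨fun ⟨⟨ha, hb⟩, hV⟩ => ⟨ha, hb, mem_Ici.2 (not_lt.1 fun hbv => hV ?_)⟩,
      fun ⟨ha, hb, hvb⟩ => ⟨⟨ha, hb⟩, fun hV => hV.2.2.not_ge hvb⟩⟩
    exact ⟨⟨(not_lt.1 hvd).trans (hmem ha hd).2, (hmem ha hb).1.1.2⟩, (hmem ha hb).1.2.1, hbv⟩

theorem exists_subset_Icc_prod_Icc (hR : IsCombRectangle R) (hRne : R.Nonempty)
    (hRT : R ⊆ classRegion 1) : ∃ v, R ⊆ Icc v 1 ×ˢ Icc 0 v := by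
  obtain ⟨A, B, -, -, rfl⟩ := hR
  have hmem {a b : ℝ} (ha : a ∈ A) (hb : b ∈ B) := mem_classRegion_one.1 (hRT (mk_mem_prod ha hb))
  obtain ⟨v, hBv, hvA⟩ := exists_between_of_forall_le hRne.snd hRne.fst
    fun b hb a ha => (hmem ha hb).2
  exact ⟨v, fun x ⟨ha, hb⟩ => ⟨⟨hvA ha, (hmem ha hb).1.1.2.le⟩, (hmem ha hb).1.2.1, hBv hb⟩⟩

theorem isRectangleWithVertices_of_cornerRect_ae_le {v : ℝ} (hv₀ : 0 < v) (hv₁ : v < 1)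
    (hR : R ⊆ Icc v 1 ×ˢ Icc 0 v) (hV : cornerRect v ≤ᵐ[law] R) :
    IsRectangleWithVertices R (1, 0) (v, v) := by
  have huIcc : uIcc ((1 : ℝ), (0 : ℝ)) (v, v) = Icc v 1 ×ˢ Icc 0 v := by
    rw [uIcc_prod_eq, uIcc_of_ge hv₁.le, uIcc_of_le hv₀.le]
  have hnull : volume (Icc v 1 ×ˢ Icc 0 v \ R) = 0 := by
    have hsquare : cornerRect v \ R ⊆ unitSquare := fun x hx =>
      (mem_openTriangle.1 (cornerRect_subset_openTriangle v hx.1)).1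
    rw [← measure_congr ((cornerRect_ae_eq v).diff (ae_eq_refl R)),
      ← Measure.restrict_eq_self _ hsquare, ← law_eq_restrict]
    exact ae_le_set.1 hV
  rw [IsRectangleWithVertices, huIcc]
  refine ⟨closure_eq_of_measure_sdiff_eq_zero (isClosed_Icc.prod isClosed_Icc) ?_ hR hnull, hnull⟩
  rw [interior_prod_eq, interior_Icc, interior_Icc, closure_prod_eq, closure_Ioo hv₁.ne,
    closure_Ioo hv₀.ne]

theorem law_real_pos_of_openTriangle_subset (hT : openTriangle ⊆ T) : 0 < law.real T := by
  have hcorner : 0 < law.real (cornerRect (1 / 2)) := by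
    rw [cornerRect, law_real_Ico_prod_Ico] <;> norm_num
  exact hcorner.trans_le (measureReal_mono ((cornerRect_subset_openTriangle _).trans hT))

end CornerRect

theorem floor_two_pow_mul_div (x : ℝ) (k m : ℕ) : ⌊2 ^ (k + m) * x⌋₊ / 2 ^ m = ⌊2 ^ k * x⌋₊ := by
  rw [← Nat.cast_ofNat (R := ℝ) (n := 2), pow_add, mul_right_comm, ← Nat.cast_pow _ m,
    Nat.mul_cast_floor_div_cancel (by positivity)]

theorem exists_floor_two_pow_mul_ne {x y : ℝ} (hy : 0 ≤ y) (hxy : y < x) :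
    ∃ k, ⌊2 ^ k * x⌋₊ ≠ ⌊2 ^ k * y⌋₊ := by
  obtain ⟨k, hk⟩ := pow_unbounded_of_one_lt (x - y)⁻¹ (one_lt_two (α := ℝ))
  refine ⟨k, fun heq => ?_⟩
  have hfloor := Nat.floor_le (mul_nonneg (pow_nonneg zero_le_two k) hy)
  have hlt := Nat.lt_floor_add_one ((2 : ℝ) ^ k * x)
  rw [inv_lt_iff_one_lt_mul₀ (sub_pos.2 hxy)] at hk
  rw [heq] at hlt
  linarith

/-- The dyadic interval `[j/2ⁿ, (j+1)/2ⁿ)`. -/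
def dyadicInterval (n j : ℕ) : Set ℝ := Ico (j / 2 ^ n) ((j + 1) / 2 ^ n)

theorem mem_dyadicInterval {n j : ℕ} {x : ℝ} :
    x ∈ dyadicInterval n j ↔ 0 ≤ x ∧ ⌊2 ^ n * x⌋₊ = j := by
  have hpow : (0 : ℝ) < 2 ^ n := by positivity
  rw [dyadicInterval, mem_Ico, div_le_iff₀' hpow, lt_div_iff₀' hpow]
  constructor
  · intro hx
    have hx₀ : 0 ≤ 2 ^ n * x := j.cast_nonneg.trans hx.1
    exact ⟨nonneg_of_mul_nonneg_right hx₀ hpow, (Nat.floor_eq_iff hx₀).2 hx⟩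
  · rintro ⟨hx, hj⟩
    exact (Nat.floor_eq_iff (by positivity)).1 hj

theorem dyadicInterval_subset_Ico {n j : ℕ} (hj : j < 2 ^ n) : dyadicInterval n j ⊆ Ico 0 1 :=
  Ico_subset_Ico (by positivity)
    ((div_le_one (by positivity)).2 (by exact_mod_cast Nat.succ_le_of_lt hj))

/-- The square of side `2⁻ᵏ⁻¹` below the diagonal that touches it at the midpoint of the `j`-th
dyadic interval of level `k`. For a point `x` of this square, `k + 1` is the first level at which
`x.1` and `x.2` lie in different dyadic intervals. -/
def dyadicSquare (k j : ℕ) : Set (ℝ × ℝ) :=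
  dyadicInterval (k + 1) (2 * j + 1) ×ˢ dyadicInterval (k + 1) (2 * j)

theorem dyadicSquare_subset_openTriangle {k j : ℕ} (hj : j < 2 ^ k) :
    dyadicSquare k j ⊆ openTriangle := fun x hx => by
  refine mem_openTriangle.2 ⟨⟨dyadicInterval_subset_Ico (by grind) hx.1,
    dyadicInterval_subset_Ico (by grind) hx.2⟩, hx.2.2.trans_le ?_⟩
  simpa using hx.1.1

theorem law_real_dyadicSquare {k j : ℕ} (hj : j < 2 ^ k) :
    law.real (dyadicSquare k j) = (4 ^ (k + 1))⁻¹ := by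
  have hj' : (2 * j + 1 + 1 : ℝ) ≤ 2 ^ (k + 1) := by
    exact_mod_cast (by grind : 2 * j + 1 + 1 ≤ 2 ^ (k + 1))
  have hpow : (4 : ℝ) ^ (k + 1) = 2 ^ (k + 1) * 2 ^ (k + 1) := by rw [← mul_pow]; norm_num
  rw [dyadicSquare, dyadicInterval, dyadicInterval, law_real_Ico_prod_Ico (by positivity)
    (by gcongr; linarith) ((div_le_one (by positivity)).2 (by exact_mod_cast hj')) (by positivity)
    (by gcongr; linarith) ((div_le_one (by positivity)).2 (by push_cast; linarith)), hpow]
  field_simp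
  ring

theorem cellEntropy_dyadicSquare {k j : ℕ} (hj : j < 2 ^ k) :
    cellEntropy (dyadicSquare k j) = ENNReal.ofReal (2 * (k + 1) / 4 ^ (k + 1)) := by
  have hlogb : Real.logb 2 4 = 2 := by
    rw [show (4 : ℝ) = 2 ^ 2 by norm_num, Real.logb_pow, Real.logb_self_eq_one one_lt_two]
    norm_num
  rw [cellEntropy, law_real_dyadicSquare hj, Real.logb_inv, Real.logb_pow, hlogb]
  congr 1
  push_cast
  ring

theorem floor_eq_of_mem_dyadicSquare {k j m : ℕ} {x : ℝ × ℝ} (hx : x ∈ dyadicSquare k j)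
    (hm : m ≤ k) : ⌊2 ^ m * x.1⌋₊ = ⌊2 ^ m * x.2⌋₊ := by
  obtain ⟨d, rfl⟩ := Nat.exists_eq_add_of_le hm
  rw [← floor_two_pow_mul_div x.1 m (d + 1), ← floor_two_pow_mul_div x.2 m (d + 1), ← add_assoc,
    (mem_dyadicInterval.1 hx.1).2, (mem_dyadicInterval.1 hx.2).2, pow_succ',
    ← Nat.div_div_eq_div_mul, ← Nat.div_div_eq_div_mul]
  congr 1
  omega

theorem level_le_of_mem_dyadicSquare {k l i j : ℕ} {x : ℝ × ℝ} (hk : x ∈ dyadicSquare k i)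
    (hl : x ∈ dyadicSquare l j) : l ≤ k := by
  by_contra! hkl
  have heq := floor_eq_of_mem_dyadicSquare hl (Nat.succ_le_of_lt hkl)
  rw [Nat.succ_eq_add_one, (mem_dyadicInterval.1 hk.1).2, (mem_dyadicInterval.1 hk.2).2] at heq
  omega

theorem exists_mem_dyadicSquare {x : ℝ × ℝ} (hx : x ∈ openTriangle) :
    ∃ k j, j < 2 ^ k ∧ x ∈ dyadicSquare k j := by
  classical
  obtain ⟨⟨⟨hx₁, hx₁'⟩, hx₂, hx₂'⟩, hlt⟩ := mem_openTriangle.1 hx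
  have hex := exists_floor_two_pow_mul_ne hx₂ hlt
  obtain ⟨k, hk⟩ : ∃ k, Nat.find hex = k + 1 := Nat.exists_eq_succ_of_ne_zero fun hzero => by
    have hne := Nat.find_spec hex
    rw [hzero, pow_zero, one_mul, one_mul, Nat.floor_eq_zero.2 hx₁',
      Nat.floor_eq_zero.2 hx₂'] at hne
    exact hne rfl
  have hne : ⌊2 ^ (k + 1) * x.1⌋₊ ≠ ⌊2 ^ (k + 1) * x.2⌋₊ := hk ▸ Nat.find_spec hex
  have heq : ⌊2 ^ k * x.1⌋₊ = ⌊2 ^ k * x.2⌋₊ := not_not.1 (Nat.find_min hex (by omega))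
  have hle : ⌊2 ^ (k + 1) * x.2⌋₊ ≤ ⌊2 ^ (k + 1) * x.1⌋₊ := by gcongr
  have hdiv₁ := floor_two_pow_mul_div x.1 k 1
  have hdiv₂ := floor_two_pow_mul_div x.2 k 1
  refine ⟨k, ⌊2 ^ k * x.1⌋₊, ?_, mem_dyadicInterval.2 ⟨hx₁, by omega⟩,
    mem_dyadicInterval.2 ⟨hx₂, by omega⟩⟩
  rw [Nat.floor_lt (by positivity)]
  push_cast
  exact mul_lt_of_lt_one_right (by positivity) hx₁'

/-- The dyadic squares in the open triangle: level `k` has `2ᵏ` of them. -/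
def dyadicFamily (i : Σ k : ℕ, Fin (2 ^ k)) : Set (ℝ × ℝ) := dyadicSquare i.1 i.2

theorem isRectPartition_dyadicFamily : IsRectPartition openTriangle dyadicFamily where
  isCombRectangle _ := isCombRectangle_Ico_prod_Ico _ _ _ _
  subset i := dyadicSquare_subset_openTriangle i.2.isLt
  disjoint := by
    rintro ⟨k, i⟩ ⟨l, j⟩ hne
    refine disjoint_left.2 fun x hk hl => hne ?_
    obtain rfl : k = l :=
      (level_le_of_mem_dyadicSquare hl hk).antisymm (level_le_of_mem_dyadicSquare hk hl)
    have hij : 2 * (i : ℕ) = 2 * j :=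
      (mem_dyadicInterval.1 hk.2).2.symm.trans (mem_dyadicInterval.1 hl.2).2
    rw [Fin.ext (Nat.mul_left_cancel two_pos hij)]
  ae_mem_iUnion := .of_forall fun x hx => by
    obtain ⟨k, j, hj, hxj⟩ := exists_mem_dyadicSquare hx
    exact mem_iUnion.2 ⟨⟨k, j, hj⟩, hxj⟩

theorem tsum_cellEntropy_dyadicFamily_ne_top : ∑' i, cellEntropy (dyadicFamily i) ≠ ∞ := by
  have hlevel (k : ℕ) : ∑' j : Fin (2 ^ k), cellEntropy (dyadicFamily ⟨k, j⟩) =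
      ENNReal.ofReal ((k + 1 : ℕ) ^ 1 * (1 / 2) ^ (k + 1)) := by
    have hpow : (4 : ℝ) ^ (k + 1) = 2 ^ (k + 1) * 2 ^ (k + 1) := by rw [← mul_pow]; norm_num
    simp only [dyadicFamily, cellEntropy_dyadicSquare (Fin.isLt _), tsum_fintype, Finset.sum_const,
      Finset.card_univ, Fintype.card_fin]
    rw [← ENNReal.ofReal_nsmul, hpow]
    congr 1
    simp only [nsmul_eq_mul, Nat.cast_pow, Nat.cast_ofNat, Nat.cast_add, Nat.cast_one, pow_one,
      one_div, inv_pow]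
    field_simp
    ring
  have hsummable : Summable fun k : ℕ => (k : ℝ) ^ 1 * (1 / 2) ^ k :=
    summable_pow_mul_geometric_of_norm_lt_one 1 (by norm_num)
  rw [ENNReal.tsum_sigma', tsum_congr hlevel]
  exact ((summable_nat_add_iff 1).2 hsummable).tsum_ofReal_ne_top

theorem classRegion_one_ae_le_openTriangle : classRegion 1 ≤ᵐ[law] openTriangle := by
  filter_upwards [ae_prod_fst_ne_snd (volume.restrict (Ico (0 : ℝ) 1))
    (volume.restrict (Ico (0 : ℝ) 1))] with x hne hx
  have hx := mem_classRegion_one.1 hx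
  exact mem_openTriangle.2 ⟨hx.1, hx.2.lt_of_ne hne.symm⟩

theorem exists_isRectPartition_tsum_cellEntropy_ne_top {T : Set (ℝ × ℝ)} (hT₀ : openTriangle ⊆ T)
    (hT₁ : T ⊆ classRegion 1) :
    ∃ F : ℕ → Set (ℝ × ℝ), IsRectPartition T F ∧ ∑' i, cellEntropy (F i) ≠ ∞ := by
  have : Infinite (Σ k : ℕ, Fin (2 ^ k)) :=
    .of_injective (fun k => ⟨k, 0⟩) fun _ _ h => congrArg Sigma.fst h
  obtain ⟨e⟩ : Nonempty (ℕ ≃ Σ k : ℕ, Fin (2 ^ k)) := nonempty_equiv_of_countable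
  refine ⟨dyadicFamily ∘ e, ?_, ?_⟩
  · exact (isRectPartition_dyadicFamily.comp_equiv e).mono_of_ae_le hT₀
      ((LE.le.eventuallyLE hT₁).trans classRegion_one_ae_le_openTriangle)
  · exact (e.tsum_eq fun i => cellEntropy (dyadicFamily i)).trans_ne
      tsum_cellEntropy_dyadicFamily_ne_top

theorem IsMinEntropyPartition.exists_isRectangleWithVertices {T : Set (ℝ × ℝ)}
    {F : ℕ → Set (ℝ × ℝ)} (hF : IsMinEntropyPartition T F) (hT₀ : openTriangle ⊆ T)
    (hT₁ : T ⊆ classRegion 1) :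
    ∃ v : ℝ, (0 < v ∧ v < 1) ∧ ∃ i, IsRectangleWithVertices (F i) (1, 0) (v, v) := by
  obtain ⟨G, hG, hGfin⟩ := exists_isRectPartition_tsum_cellEntropy_ne_top hT₀ hT₁
  have hfin : ∑' i, cellEntropy (F i) ≠ ∞ := ne_top_of_le_ne_top hGfin (hF.entropy_le G hG)
  have hrect (i : ℕ) : F i ⊆ classRegion 1 := (hF.subset i).trans hT₁
  obtain ⟨k, hpos, hmax⟩ := hF.exists_largest_cell (law_real_pos_of_openTriangle_subset hT₀)
  obtain ⟨v, hv⟩ := exists_subset_Icc_prod_Icc (hF.isCombRectangle k)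
    (nonempty_of_measureReal_ne_zero hpos.ne') (hrect k)
  have hle : F k ≤ᵐ[law] cornerRect v := by
    rw [law_eq_restrict]
    exact (LE.le.eventuallyLE hv).trans (ae_restrict_of_ae (cornerRect_ae_eq v).symm.le)
  have heq : F k =ᵐ[law] cornerRect v := hF.ae_eq_of_ae_le hfin hpos hmax
    (isCombRectangle_cornerRect v) ((cornerRect_subset_openTriangle v).trans hT₀)
    (fun i => isCombRectangle_sdiff_cornerRect (hF.isCombRectangle i) (hrect i) v) hle
  obtain ⟨x, hx₁, hx₂⟩ : (cornerRect v).Nonempty :=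
    nonempty_of_measureReal_ne_zero (measureReal_congr heq ▸ hpos.ne')
  have hv₀ : 0 < v := hx₂.1.trans_lt hx₂.2
  have hv₁ : v < 1 := hx₁.1.trans_lt hx₁.2
  exact ⟨v, ⟨hv₀, hv₁⟩, k, isRectangleWithVertices_of_cornerRect_ae_le hv₀ hv₁ hv heq.symm.le⟩

theorem IsRectangleWithVertices.of_preimage_swap {R : Set (ℝ × ℝ)} {a b : ℝ × ℝ}
    (hR : IsRectangleWithVertices (Prod.swap ⁻¹' R) a b) :
    IsRectangleWithVertices R a.swap b.swap := by
  have huIcc : uIcc a b = Prod.swap ⁻¹' uIcc a.swap b.swap := by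
    rw [uIcc_prod_eq, uIcc_prod_eq, preimage_swap_prod]
    rfl
  obtain ⟨hclosure, hnull⟩ := hR
  rw [huIcc] at hclosure hnull
  constructor
  · refine preimage_injective.2 Prod.swap_surjective ?_
    rw [← hclosure]
    exact (Homeomorph.prodComm ℝ ℝ).preimage_closure R
  · have hswap : MeasurePreserving (Prod.swap : ℝ × ℝ → ℝ × ℝ) volume volume :=
      Measure.measurePreserving_swap
    rwa [← hswap.measure_preimage_equiv (f := MeasurableEquiv.prodComm)]

namespace ZeroErrorPartition

/-- The zero-error partition consisting of a partition of each of the two classes. -/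
def ofRectPartitions {F G : ℕ → Set (ℝ × ℝ)} (hF : IsRectPartition (classRegion 1) F)
    (hG : IsRectPartition (classRegion 0) G) : ZeroErrorPartition where
  P := F
  Q := G
  rect_P := hF.isCombRectangle
  rect_Q := hG.isCombRectangle
  sub_P := hF.subset
  sub_Q := hG.subset
  disjoint_P _ _ hij := hF.disjoint hij
  disjoint_Q _ _ hij := hG.disjoint hij
  cover := by
    have hsquare : ∀ᵐ x ∂law, x ∈ unitSquare := by
      rw [law_eq_restrict]
      exact ae_restrict_mem (measurableSet_Ico.prod measurableSet_Ico)
    filter_upwards [hsquare, hF.ae_mem_iUnion, hG.ae_mem_iUnion] with x hx hFx hGx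
    rcases le_or_gt x.2 x.1 with hle | hlt
    · exact .inl (hFx (mem_classRegion_one.2 ⟨hx, hle⟩))
    · exact .inr (hGx (mem_classRegion_zero.2 ⟨hx, hlt⟩))

variable (𝒮 : ZeroErrorPartition)

theorem isRectPartition_P : IsRectPartition (classRegion 1) 𝒮.P where
  isCombRectangle := 𝒮.rect_P
  subset := 𝒮.sub_P
  disjoint := 𝒮.disjoint_P
  ae_mem_iUnion := by
    filter_upwards [𝒮.cover] with x hx hx₁
    refine hx.resolve_right fun hxQ => ?_
    obtain ⟨i, hi⟩ := mem_iUnion.1 hxQ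
    exact zero_ne_one ((𝒮.sub_Q i hi).2.symm.trans hx₁.2)

theorem isRectPartition_Q : IsRectPartition (classRegion 0) 𝒮.Q where
  isCombRectangle := 𝒮.rect_Q
  subset := 𝒮.sub_Q
  disjoint := 𝒮.disjoint_Q
  ae_mem_iUnion := by
    filter_upwards [𝒮.cover] with x hx hx₀
    refine hx.resolve_left fun hxP => ?_
    obtain ⟨i, hi⟩ := mem_iUnion.1 hxP
    exact one_ne_zero ((𝒮.sub_P i hi).2.symm.trans hx₀.2)

namespace MinimizesEntropy

variable {𝒮}

theorem entropy_ne_top (h𝒮 : 𝒮.MinimizesEntropy) : 𝒮.entropy ≠ ∞ := by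
  obtain ⟨F, hF, hFfin⟩ := exists_isRectPartition_tsum_cellEntropy_ne_top
    openTriangle_subset_classRegion_one Subset.rfl
  obtain ⟨G, hG, hGfin⟩ := exists_isRectPartition_tsum_cellEntropy_ne_top
    Subset.rfl openTriangle_subset_classRegion_one
  refine ne_top_of_le_ne_top ?_ (h𝒮 (ofRectPartitions hF hG.preimage_swap))
  simp only [entropy, ofRectPartitions, cellEntropy_preimage_swap]
  exact ENNReal.add_ne_top.2 ⟨hFfin, hGfin⟩

theorem isMinEntropyPartition_P (h𝒮 : 𝒮.MinimizesEntropy) :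
    IsMinEntropyPartition (classRegion 1) 𝒮.P where
  toIsRectPartition := 𝒮.isRectPartition_P
  entropy_le _ hG := (ENNReal.add_le_add_iff_right (ENNReal.add_ne_top.1 h𝒮.entropy_ne_top).2).1
    (h𝒮 (ofRectPartitions hG 𝒮.isRectPartition_Q))

theorem isMinEntropyPartition_Q (h𝒮 : 𝒮.MinimizesEntropy) :
    IsMinEntropyPartition (classRegion 0) 𝒮.Q where
  toIsRectPartition := 𝒮.isRectPartition_Q
  entropy_le _ hG := (ENNReal.add_le_add_iff_left (ENNReal.add_ne_top.1 h𝒮.entropy_ne_top).1).1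
    (h𝒮 (ofRectPartitions 𝒮.isRectPartition_P hG))

end MinimizesEntropy

end ZeroErrorPartition

end ComparisonPartition

theorem mainTheorem4 (𝒮 : ComparisonPartition.ZeroErrorPartition)
    (h𝒮 : 𝒮.MinimizesEntropy) :
    ∃ u v : ℝ, (0 < u ∧ u < 1) ∧ (0 < v ∧ v < 1) ∧
      (∃ i, ComparisonPartition.IsRectangleWithVertices (𝒮.P i) (1, 0) (v, v)) ∧
      (∃ j, ComparisonPartition.IsRectangleWithVertices (𝒮.Q j) (0, 1) (u, u)) := by
  obtain ⟨v, hv, hP⟩ := h𝒮.isMinEntropyPartition_P.exists_isRectangleWithVertices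
    ComparisonPartition.openTriangle_subset_classRegion_one Subset.rfl
  obtain ⟨u, hu, j, hQ⟩ :=
    h𝒮.isMinEntropyPartition_Q.preimage_swap.exists_isRectangleWithVertices
      Subset.rfl ComparisonPartition.openTriangle_subset_classRegion_one
  exact ⟨u, v, hu, hv, hP, j, hQ.of_preimage_swap⟩
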